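/- Let $k\ge 0$ and $n>36k$ be integers, let $[n]=\{1,\dots,n\}$, and let $\mathcal F\subseteq\binom{[n]}{k}$ be a family of $k$-element subsets of $[n]$ that is intersecting, i.e. $F\cap F'\neq\emptyset$ for all $F,F'\in\mathcal F$. Let $\Delta(\mathcal F)=\max_{1\le x\le n}|\{F\in\mathcal F: x\in F\}|$ be the maximum degree of $\mathcal F$, let $\varrho(\mathcal F)=\Delta(\mathcal F)/|\mathcal F|$, and let $$\mathcal F_3=\left\{F\in\tbinom{[n]}{k}: 1\in F,\ F\cap\{2,3\}\ne\emptyset\right\}\cup\left\{F\in\tbinom{[n]}{k}:\{2,3\}\subseteq F\right\}.$$ Suppose that $|\mathcal F|\ge|\mathcal F_3|+1$. Then $$\varrho(\mathcal F)>1-\max\{k+4,40\}\cdot\frac{k}{3n}.$$ If, moreover, $|\mathcal F|\ge|\mathcal F_3|+\frac d2\binom{n-d+3}{k-d+3}$ for some integer $d\ge 40$, where $\binom{a}{b}=0$ if $a<0$ or $b<0$, then $$\varrho(\mathcal F)>1-\frac{dk}{3n}.$$ (When $d\le k+3$ the binomial coefficient is positive, so the second size condition implies $|\mathcal F|\ge|\mathcal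 F_3|+1$.) -/

import Mathlib

namespace IntersectingFamilies

/-- The number of members of `F` that contain `x`. It is the size of the link
`{A \ {x} : x ∈ A ∈ F}`, because `A ↦ A \ {x}` is injective on the sets containing `x`. -/
def degree (F : Finset (Finset ℕ)) (x : ℕ) : ℕ :=
  (F.filter fun A => x ∈ A).card

/-- The maximum degree `Δ(F)` of a family `F` of subsets of `[n] = {1, …, n}`. -/
def maxDegree (n : ℕ) (F : Finset (Finset ℕ)) : ℕ :=
  (Finset.Icc 1 n).sup (degree F)

/-- The degree ratio `ϱ(F) = Δ(F) / |F|` (meaningful for nonempty `F`). -/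
noncomputable def degreeRatio (n : ℕ) (F : Finset (Finset ℕ)) : ℝ :=
  (maxDegree n F : ℝ) / (F.card : ℝ)

/-- The family `F_i(n, k)` of all `k`-subsets `A` of `[n]` such that either `1 ∈ A` and `A` meets
`[2, i]`, or `[2, i] ⊆ A`. -/
def frankl (n k i : ℕ) : Finset (Finset ℕ) :=
  (Finset.powersetCard k (Finset.Icc 1 n)).filter fun A =>
    (1 ∈ A ∧ (A ∩ Finset.Icc 2 i).Nonempty) ∨ Finset.Icc 2 i ⊆ A

/-- The binomial coefficient with integer arguments, equal to zero if an argument is negative. -/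
def binom (a b : ℤ) : ℕ :=
  if 0 ≤ a ∧ 0 ≤ b then a.toNat.choose b.toNat else 0

end IntersectingFamilies

/-! Let the members have size k+2 and let n = k+q+4 (sizes at most 1 are trivial). The family F₃ has
at least 2·C(n-3,k) + C(n-2,k) members. It suffices to find a vertex x missed by at most C(n-4,k-1)
members: this is a fraction k/(n-3) of C(n-3,k), hence a small proportion of the family, and both
claimed bounds follow with the coefficient 40.

Two facts produce x. The first is a gap (`card_notMem_le_of_le`): Kruskal–Katona, applied to
complements, shows that a vertex missed by at most C(n-3,k) members of so large a family is already
missed by at most C(n-4,k-1). The second is that some vertex is missed by at most C(n-3,k) members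
(`exists_card_notMem_le`).

For the second, suppose every vertex is missed more often. Shifting preserves this: if a shift j → i
spoiled it at i, the gap would leave few members avoiding both i and j, so the members containing
exactly one of i, j would form two large cross-intersecting links. Bounding these and the remaining
two links contradicts the size of the family (`lt_card_notMem_shift`). So the family may be taken
shifted. There Katona's shadow theorem bounds the members missing 1 by one link inside [4,n] plus
six copies of a much sparser one, and cross-intersection bounds this total by C(n-3,k)
(`card_notMem_one_le_of_shifted`). -/

namespace IntersectingFamilies

open Finset
open scoped FinsetFamily

/-! ### Shadows of small families -/

/-- If `E` contains all `l`-subsets of the members of a family `D` of `h`-subsets of `S`, then the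
density of `E` is at least that of `D`. -/
theorem card_mul_choose_le_card_mul_choose {α : Type*} [DecidableEq α] {S : Finset α}
    {D E : Finset (Finset α)} {h l : ℕ} (hD : D ⊆ powersetCard h S)
    (hE : ∀ A ∈ D, ∀ T ⊆ A, #T = l → T ∈ E) :
    #D * h.choose l ≤ #E * (#S - l).choose (h - l) := by
  have hsub : #(E.filter fun T => #T = l ∧ T ⊆ S) ≤ #E := card_filter_le _ _
  refine le_trans ?_ (Nat.mul_le_mul_right _ hsub)
  refine card_mul_le_card_mul (fun A T : Finset α => T ⊆ A) (fun A hA => ?_) fun T hT => ?_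
  · have hA' := mem_powersetCard.1 (hD hA)
    rw [← hA'.2, ← card_powersetCard]
    refine card_le_card fun T hT => ?_
    rw [mem_powersetCard] at hT
    rw [mem_bipartiteAbove, mem_filter]
    exact ⟨⟨hE A hA T hT.1 hT.2, hT.2, hT.1.trans hA'.1⟩, hT.1⟩
  · rw [mem_filter] at hT
    obtain ⟨-, hTl, hTS⟩ := hT
    rw [← hTl, ← card_sdiff_of_subset hTS, ← card_powersetCard]
    refine card_le_card_of_injOn (fun A => A \ T) (fun A hA => ?_) fun A hA A' hA' hAA => ?_
    · rw [mem_coe, mem_bipartiteBelow] at hA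
      have hA' := mem_powersetCard.1 (hD hA.1)
      rw [mem_coe, mem_powersetCard, card_sdiff_of_subset hA.2, hA'.2]
      exact ⟨sdiff_subset_sdiff hA'.1 le_rfl, rfl⟩
    · rw [mem_coe, mem_bipartiteBelow] at hA hA'
      rw [← sdiff_union_of_subset hA.2, ← sdiff_union_of_subset hA'.2]
      exact congrArg (· ∪ T) hAA

/-- The initial segment of `Fin m` of length `N`. -/
def below (m N : ℕ) : Finset (Fin m) := univ.filter fun i => i.val < N

theorem mem_below {m N : ℕ} {i : Fin m} : i ∈ below m N ↔ i.val < N := by simp [below]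

theorem card_below {m N : ℕ} (h : N ≤ m) : #(below m N) = N := by
  rw [below, Fin.card_filter_val_lt, min_eq_right h]

theorem isInitSeg_powersetCard_below (m N h : ℕ) :
    Colex.IsInitSeg (powersetCard h (below m N)) h := by
  refine ⟨Set.sized_powersetCard _ _, ?_⟩
  simp_rw [mem_powersetCard]
  rintro A B hA ⟨HB₁, HB₂⟩
  refine ⟨fun t ht ↦ ?_, ‹_›⟩
  rw [mem_below]
  have : toColex (image Fin.val B) < toColex (image Fin.val A) := by
    rwa [Colex.toColex_image_lt_toColex_image Fin.val_strictMono]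
  apply Colex.forall_lt_mono this.le _ t (mem_image.2 ⟨t, ht, rfl⟩)
  simp_rw [mem_image]
  rintro _ ⟨a, ha, hab⟩
  have := hA.1 ha
  rw [mem_below] at this
  omega

/-- Deleting the colex-largest member of an initial segment leaves an initial segment, so every size
is reached downward from the full level. -/
theorem exists_isInitSeg_card_eq {m h c : ℕ} (hc : c ≤ m.choose h) :
    ∃ C : Finset (Finset (Fin m)), Colex.IsInitSeg C h ∧ #C = c := by
  induction hc using Nat.decreasingInduction with
  | self =>
    exact ⟨_, isInitSeg_powersetCard_below m m h, by rw [card_powersetCard, card_below le_rfl]⟩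
  | of_succ c _ ih =>
    obtain ⟨C, ⟨hC, hC'⟩, hcard⟩ := ih
    obtain ⟨s, hs, hmax⟩ := exists_max_image C toColex (card_pos.1 (by omega))
    refine ⟨C.erase s, ⟨fun A hA => hC (mem_of_mem_erase hA), fun A B hA hB => ?_⟩,
      by rw [card_erase_of_mem hs]; omega⟩
    refine mem_erase.2 ⟨?_, hC' (mem_of_mem_erase hA) hB⟩
    rintro rfl
    exact (hmax A (mem_of_mem_erase hA)).not_gt hB.1

theorem isInitSeg_subset_of_card_le {m h : ℕ} {C D : Finset (Finset (Fin m))}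
    (hC : Colex.IsInitSeg C h) (hD : Colex.IsInitSeg D h) (hCD : #C ≤ #D) : C ⊆ D := by
  rcases hC.total hD with H | H
  · exact H
  · exact (eq_of_subset_of_card_le H hCD).ge

section Colex

variable {m h l N : ℕ} {A E : Finset (Finset (Fin m))}

/-- The Kruskal–Katona theorem, comparing with an arbitrary initial segment of the same size. -/
theorem exists_isInitSeg_shadow_le (hA : (A : Set (Finset (Fin m))).Sized h)
    (hE : ∀ B ∈ A, ∀ T ⊆ B, #T = l → T ∈ E) (hl : l ≤ h) :
    ∃ C G : Finset (Finset (Fin m)), Colex.IsInitSeg C h ∧ #C = #A ∧ #G ≤ #E ∧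
      ∀ B ∈ C, ∀ T ⊆ B, #T = l → T ∈ G := by
  have hle : #A ≤ m.choose h := by simpa using hA.card_le
  obtain ⟨C, hC, hcard⟩ := exists_isInitSeg_card_eq hle
  refine ⟨C, ∂^[h - l] C, hC, hcard,
    (iterated_kk (k := h - l) hA hcard.le hC).trans (card_le_card fun T hT => ?_), ?_⟩
  · rw [mem_shadow_iterate_iff_exists_mem_card_add] at hT
    obtain ⟨B, hB, hTB, hcard'⟩ := hT
    have := hA hB
    exact hE B hB T hTB (by omega)
  · intro B hB T hTB hT
    rw [mem_shadow_iterate_iff_exists_mem_card_add]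
    have := hC.1 hB
    exact ⟨B, hB, hTB, by omega⟩

/-- The initial segment of the same size lives on only N points, so double counting can be done with
N in place of m. -/
theorem shadow_density_le (hA : (A : Set (Finset (Fin m))).Sized h)
    (hE : ∀ B ∈ A, ∀ T ⊆ B, #T = l → T ∈ E) (hl : l ≤ h) (hN : N ≤ m) (hcard : #A ≤ N.choose h) :
    #A * h.choose l ≤ #E * (N - l).choose (h - l) := by
  obtain ⟨C, G, hC, hCA, hGE, hG⟩ := exists_isInitSeg_shadow_le hA hE hl
  have hsub : C ⊆ powersetCard h (below m N) :=
    isInitSeg_subset_of_card_le hC (isInitSeg_powersetCard_below m N h)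
      (by rw [card_powersetCard, card_below hN]; omega)
  have := card_mul_choose_le_card_mul_choose hsub hG
  rw [card_below hN, hCA] at this
  exact this.trans (Nat.mul_le_mul_right _ hGE)

theorem choose_le_card_shadow (hA : (A : Set (Finset (Fin m))).Sized h)
    (hE : ∀ B ∈ A, ∀ T ⊆ B, #T = l → T ∈ E) (hl : l ≤ h) (hhN : h ≤ N) (hN : N ≤ m)
    (hcard : N.choose h ≤ #A) : N.choose l ≤ #E := by
  have := kruskal_katona_lovasz_form (i := h - l) (by omega) hhN hN hA hcard
  rw [Nat.sub_sub_self hl] at this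
  refine this.trans (card_le_card fun T hT => ?_)
  rw [mem_shadow_iterate_iff_exists_mem_card_add] at hT
  obtain ⟨B, hB, hTB, hcard'⟩ := hT
  have := hA hB
  exact hE B hB T hTB (by omega)

/-- The comparison segment consists of all `h`-subsets of N points together with some sets through
one further point `p`. Since (h-1) + (l-1) = N, double counting in the links at `p` loses nothing:
beyond C(N,h), each new set forces at least one new `l`-set beyond C(N,l). -/
theorem card_add_choose_le_card_shadow_add_choose (hA : (A : Set (Finset (Fin m))).Sized h)
    (hE : ∀ B ∈ A, ∀ T ⊆ B, #T = l → T ∈ E) (hl : l ≤ h) (hl' : 1 ≤ l) (hN : N + 1 ≤ m)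
    (hlh : l + h = N + 2) (hlow : N.choose h < #A) (hupp : #A ≤ (N + 1).choose h) :
    #A + N.choose l ≤ #E + N.choose h := by
  rcases lt_or_ge N h with hNh | hhN
  · obtain rfl : h = N + 1 := by omega
    obtain rfl : l = 1 := by omega
    rw [Nat.choose_self] at hupp
    obtain ⟨B, hB⟩ := card_pos.1 (by omega : 0 < #A)
    have := card_mul_choose_le_card_mul_choose (S := B) (D := {B}) (E := E) (h := N + 1) (l := 1)
      (by simp [hA hB]) (by simpa using hE B hB)
    simp [hA hB] at this
    simp
    omega
  obtain ⟨C, G, hC, hCA, hGE, hG⟩ := exists_isInitSeg_shadow_le hA hE hl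
  have hsub : C ⊆ powersetCard h (below m (N + 1)) :=
    isInitSeg_subset_of_card_le hC (isInitSeg_powersetCard_below m _ h)
      (by rw [card_powersetCard, card_below hN]; omega)
  have hsup : powersetCard h (below m N) ⊆ C :=
    isInitSeg_subset_of_card_le (isInitSeg_powersetCard_below m N h) hC
      (by rw [card_powersetCard, card_below (by omega)]; omega)
  let p : Fin m := ⟨N, by omega⟩
  have hp : ∀ B, B ⊆ below m (N + 1) → p ∉ B → B ⊆ below m N := by
    intro B hB hpB i hi
    have h1 := mem_below.1 (hB hi)
    have h2 : i ≠ p := fun h => hpB (h ▸ hi)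
    rw [mem_below]
    have : i.val ≠ N := fun h => h2 (Fin.ext h)
    omega
  have hpN : p ∉ below m N := by simp [mem_below, p]
  have hC1 : #(C.nonMemberSubfamily p) ≤ N.choose h := by
    rw [← card_below (m := m) (N := N) (by omega), ← card_powersetCard]
    refine card_le_card fun B hB => ?_
    rw [mem_nonMemberSubfamily] at hB
    have := mem_powersetCard.1 (hsub hB.1)
    exact mem_powersetCard.2 ⟨hp B this.1 hB.2, this.2⟩
  have hG1 : N.choose l ≤ #(G.nonMemberSubfamily p) := by
    rw [← card_below (m := m) (N := N) (by omega), ← card_powersetCard]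
    refine card_le_card fun T hT => ?_
    rw [mem_powersetCard] at hT
    rw [mem_nonMemberSubfamily]
    obtain ⟨B, hTB, hB, hBc⟩ := exists_subsuperset_card_eq (n := h) hT.1 (by omega)
      (by rw [card_below (by omega)]; exact hhN)
    exact ⟨hG B (hsup (mem_powersetCard.2 ⟨hB, hBc⟩)) T hTB hT.2, fun h => hpN (hT.1 h)⟩
  have hD := card_mul_choose_le_card_mul_choose (S := below m N) (D := C.memberSubfamily p)
    (E := G.memberSubfamily p) (h := h - 1) (l := l - 1) (fun B hB => by
      rw [mem_memberSubfamily] at hB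
      have := mem_powersetCard.1 (hsub hB.1)
      rw [card_insert_of_notMem hB.2] at this
      exact mem_powersetCard.2 ⟨hp B ((subset_insert _ _).trans this.1) hB.2, by omega⟩)
    (fun B hB T hTB hT => by
      rw [mem_memberSubfamily] at hB ⊢
      have hpT : p ∉ T := fun h => hB.2 (hTB h)
      exact ⟨hG _ hB.1 _ (insert_subset_insert _ hTB)
        (by rw [card_insert_of_notMem hpT]; omega), hpT⟩)
  rw [card_below (by omega), show N - (l - 1) = h - 1 by omega,
    Nat.choose_symm (by omega : l - 1 ≤ h - 1)] at hD
  have hD' := Nat.le_of_mul_le_mul_right hD (Nat.choose_pos (by omega))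
  have e1 := card_memberSubfamily_add_card_nonMemberSubfamily p C
  have e2 := card_memberSubfamily_add_card_nonMemberSubfamily p G
  omega

end Colex

/-! ### Cross-intersecting families -/

/-- Complementation turns disjointness from a member of `B` into containment. -/
theorem exists_compl_family {S : Finset ℕ} {r s : ℕ} {B E : Finset (Finset ℕ)}
    (hB : B ⊆ powersetCard r S)
    (hE : ∀ b ∈ B, ∀ T ⊆ S, #T = s → Disjoint T b → T ∈ E) :
    ∃ A G : Finset (Finset (Fin #S)), (A : Set (Finset (Fin #S))).Sized (#S - r) ∧ #A = #B ∧
      #G ≤ #E ∧ ∀ b ∈ A, ∀ T ⊆ b, #T = s → T ∈ G := by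
  let f : Fin #S ↪ ℕ := (S.orderEmbOfFin rfl).toEmbedding
  have hfS : ∀ i, f i ∈ S := fun i => S.orderEmbOfFin_mem rfl i
  have hfsurj : ∀ x ∈ S, ∃ i, f i = x := by
    intro x hx
    have : x ∈ Set.range (S.orderEmbOfFin rfl) := by rw [range_orderEmbOfFin]; exact hx
    exact this
  let pre : Finset ℕ → Finset (Fin #S) := fun b => univ.filter fun i => f i ∈ b
  have hpre : ∀ b ⊆ S, (pre b).map f = b := by
    intro b hb
    ext x
    simp only [pre, mem_map, mem_filter, mem_univ, true_and]
    constructor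
    · rintro ⟨i, hi, rfl⟩; exact hi
    · intro hx
      obtain ⟨i, rfl⟩ := hfsurj x (hb hx)
      exact ⟨i, hx, rfl⟩
  refine ⟨B.image fun b => (pre b)ᶜ, univ.filter fun T => T.map f ∈ E, ?_, ?_, ?_, ?_⟩
  · intro A hA
    simp only [coe_image, Set.mem_image, mem_coe] at hA
    obtain ⟨b, hb, rfl⟩ := hA
    have := mem_powersetCard.1 (hB hb)
    rw [card_compl, Fintype.card_fin, ← card_map f, hpre b this.1, this.2]
  · refine card_image_of_injOn fun b hb b' hb' hbb => ?_
    rw [← hpre b (mem_powersetCard.1 (hB hb)).1, ← hpre b' (mem_powersetCard.1 (hB hb')).1,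
      compl_injective hbb]
  · refine card_le_card_of_injOn (fun T => T.map f) (fun T hT => ?_) fun T _ T' _ h =>
      map_injective f h
    simpa using hT
  · intro A hA T hTA hT
    obtain ⟨b, hb, rfl⟩ := mem_image.1 hA
    simp only [mem_filter, mem_univ, true_and]
    refine hE b hb _ (fun x hx => ?_) (by rw [card_map, hT]) ?_
    · obtain ⟨i, -, rfl⟩ := mem_map.1 hx
      exact hfS i
    · rw [disjoint_left]
      intro x hx hxb
      obtain ⟨i, hi, rfl⟩ := mem_map.1 hx
      have := hTA hi
      simp [pre] at this
      exact this hxb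

section Cross

variable {S : Finset ℕ} {m r s N : ℕ} {B E : Finset (Finset ℕ)}

/-- An `s`-set is disjoint from b exactly when it lies in the complement of b, an (m-r)-set; so this
and the next two results are the shadow bounds for the family of complements. -/
theorem card_mul_choose_le_of_disjoint (hm : #S = m) (hB : B ⊆ powersetCard r S)
    (hE : ∀ b ∈ B, ∀ T ⊆ S, #T = s → Disjoint T b → T ∈ E) (hrs : s + r ≤ m) (hN : N ≤ m)
    (hcard : #B ≤ N.choose (m - r)) :
    #B * (m - r).choose s ≤ #E * (N - s).choose (m - r - s) := by
  subst hm
  obtain ⟨A, G, hA, hAB, hGE, hG⟩ := exists_compl_family hB hE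
  rw [← hAB] at hcard ⊢
  exact (shadow_density_le hA hG (by omega) hN hcard).trans (Nat.mul_le_mul_right _ hGE)

theorem choose_le_card_of_disjoint (hm : #S = m) (hB : B ⊆ powersetCard r S)
    (hE : ∀ b ∈ B, ∀ T ⊆ S, #T = s → Disjoint T b → T ∈ E) (hrs : s + r ≤ m) (hN : N ≤ m)
    (hmN : m - r ≤ N) (hcard : N.choose (m - r) ≤ #B) : N.choose s ≤ #E := by
  subst hm
  obtain ⟨A, G, hA, hAB, hGE, hG⟩ := exists_compl_family hB hE
  rw [← hAB] at hcard
  exact (choose_le_card_shadow hA hG (by omega) hmN hN hcard).trans hGE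

theorem card_add_choose_le_of_disjoint (hm : #S = m) (hB : B ⊆ powersetCard r S)
    (hE : ∀ b ∈ B, ∀ T ⊆ S, #T = s → Disjoint T b → T ∈ E) (hs : 1 ≤ s) (hrs : s + r ≤ m)
    (hN : N + 1 ≤ m) (hsN : s + (m - r) = N + 2) (hlow : N.choose (m - r) < #B)
    (hupp : #B ≤ (N + 1).choose (m - r)) :
    #B + N.choose s ≤ #E + N.choose (m - r) := by
  subst hm
  obtain ⟨A, G, hA, hAB, hGE, hG⟩ := exists_compl_family hB hE
  rw [← hAB] at hlow hupp ⊢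
  have := card_add_choose_le_card_shadow_add_choose hA hG (by omega) hs hN hsN hlow hupp
  omega

/-- The families of `s`-subsets of `S` cross-intersecting `B`, together with the `s`-subsets of `S`
disjoint from some member of `B`, have total size at most `C(|S|, s)`. -/
theorem exists_disjoint_cover (hm : #S = m) {A : Finset (Finset ℕ)} (hA : A ⊆ powersetCard s S)
    (hAB : ∀ a ∈ A, ∀ b ∈ B, ¬ Disjoint a b) :
    ∃ E : Finset (Finset ℕ), (∀ b ∈ B, ∀ T ⊆ S, #T = s → Disjoint T b → T ∈ E) ∧
      #A + #E = m.choose s := by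
  refine ⟨powersetCard s S \ A, fun b hb T hT hTs hd => ?_, ?_⟩
  · exact mem_sdiff.2 ⟨mem_powersetCard.2 ⟨hT, hTs⟩, fun h => hAB T h b hb hd⟩
  · rw [card_sdiff_of_subset hA, card_powersetCard, hm, ← hm, ← card_powersetCard]
    have := card_le_card hA
    omega

/-- The Erdős–Ko–Rado theorem. -/
theorem card_le_choose_of_intersecting (hm : #S = m) (hB : B ⊆ powersetCard r S)
    (hint : ∀ a ∈ B, ∀ b ∈ B, ¬ Disjoint a b) (hrm : 2 * r ≤ m) :
    #B ≤ (m - 1).choose (m - r) := by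
  rcases Nat.eq_zero_or_pos r with rfl | hr
  · rcases B.eq_empty_or_nonempty with rfl | ⟨b, hb⟩
    · simp
    · have := (mem_powersetCard.1 (hB hb)).2
      rw [card_eq_zero] at this
      exact absurd (this ▸ disjoint_empty_left b) (hint b hb b hb)
  by_contra! h
  -- The family cross-intersects itself. If it were too large, at least C(m-1,r) sets would be
  -- disjoint from some member, leaving it only C(m-1,r-1).
  obtain ⟨E, hE, hBE⟩ := exists_disjoint_cover hm hB hint
  have h1 := choose_le_card_of_disjoint hm hB hE (by omega) (by omega : m - 1 ≤ m) (by omega) h.le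
  have h2 : m.choose r = (m - 1).choose (r - 1) + (m - 1).choose r := by
    obtain ⟨m, rfl⟩ : ∃ q, m = q + 1 := ⟨m - 1, by omega⟩
    obtain ⟨r, rfl⟩ : ∃ q, r = q + 1 := ⟨r - 1, by omega⟩
    exact Nat.choose_succ_succ _ _
  rw [Nat.choose_symm_of_eq_add (show m - 1 = (m - r) + (r - 1) by omega)] at h
  omega

end Cross

/-! ### Shifting -/

/-- The family `F` is closed under replacing `j` by a smaller element `i` of `S`. -/
def Shifted (S : Finset ℕ) (F : Finset (Finset ℕ)) : Prop :=
  ∀ i ∈ S, ∀ j ∈ S, i < j → ∀ A ∈ F, i ∉ A → j ∈ A → insert i (A.erase j) ∈ F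

/-- The map underlying the `(i, j)`-shift of `F`. -/
def shiftMap (i j : ℕ) (F : Finset (Finset ℕ)) (A : Finset ℕ) : Finset ℕ :=
  if i ∉ A ∧ j ∈ A ∧ insert i (A.erase j) ∉ F then insert i (A.erase j) else A

/-- The `(i, j)`-shift of `F`. -/
def shift (i j : ℕ) (F : Finset (Finset ℕ)) : Finset (Finset ℕ) := F.image (shiftMap i j F)

section Shift

variable {i j : ℕ} {F : Finset (Finset ℕ)}

theorem shiftMap_injOn : Set.InjOn (shiftMap i j F) F := by
  intro A hA B hB h
  rw [mem_coe] at hA hB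
  unfold shiftMap at h
  split_ifs at h with h1 h2 h2
  · have := congrArg (fun X => insert j (X.erase i)) h
    rwa [erase_insert (fun h => h1.1 (mem_of_mem_erase h)),
      erase_insert (fun h => h2.1 (mem_of_mem_erase h)), insert_erase h1.2.1,
      insert_erase h2.2.1] at this
  · exact absurd (h ▸ hB) h1.2.2
  · exact absurd (h ▸ hA) h2.2.2
  · exact h

theorem card_shift : #(shift i j F) = #F := card_image_of_injOn shiftMap_injOn

theorem card_shiftMap (A : Finset ℕ) : #(shiftMap i j F A) = #A := by
  unfold shiftMap
  split_ifs with h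
  · rw [card_insert_of_notMem (fun h' => h.1 (mem_of_mem_erase h')), card_erase_add_one h.2.1]
  · rfl

theorem shiftMap_subset (A : Finset ℕ) : shiftMap i j F A ⊆ insert i A := by
  unfold shiftMap
  split_ifs
  · exact insert_subset_insert _ (erase_subset _ _)
  · exact subset_insert _ _

theorem shift_subset {k : ℕ} {S : Finset ℕ} (hF : F ⊆ powersetCard k S) (hi : i ∈ S) :
    shift i j F ⊆ powersetCard k S := by
  intro A hA
  obtain ⟨B, hB, rfl⟩ := mem_image.1 hA
  have := mem_powersetCard.1 (hF hB)
  exact mem_powersetCard.2 ⟨(shiftMap_subset B).trans (insert_subset hi this.1),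
    by rw [card_shiftMap, this.2]⟩

theorem shift_cases {A : Finset ℕ} (hA : A ∈ shift i j F) :
    (A ∈ F ∧ (i ∉ A → j ∈ A → insert i (A.erase j) ∈ F)) ∨
      (i ∈ A ∧ ∃ B ∈ F, i ∉ B ∧ j ∈ B ∧ A = insert i (B.erase j)) := by
  obtain ⟨B, hB, rfl⟩ := mem_image.1 hA
  unfold shiftMap
  split_ifs with h
  · exact Or.inr ⟨mem_insert_self _ _, B, hB, h.1, h.2.1, rfl⟩
  · refine Or.inl ⟨hB, fun h1 h2 => ?_⟩
    by_contra h3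
    exact h ⟨h1, h2, h3⟩

theorem mem_shift_of_notMem {A : Finset ℕ} (hA : A ∈ F) (hj : j ∉ A) : A ∈ shift i j F :=
  mem_image.2 ⟨A, hA, by simp [shiftMap, hj]⟩

theorem shift_intersecting (hij : i ≠ j) (hF : ∀ A ∈ F, ∀ B ∈ F, ¬ Disjoint A B) :
    ∀ A ∈ shift i j F, ∀ B ∈ shift i j F, ¬ Disjoint A B := by
  have key : ∀ A B, (A ∈ F ∧ (i ∉ A → j ∈ A → insert i (A.erase j) ∈ F)) →
      (i ∈ B ∧ ∃ C ∈ F, i ∉ C ∧ j ∈ C ∧ B = insert i (C.erase j)) → ¬ Disjoint A B := by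
    rintro A B ⟨hA, hA'⟩ ⟨hiB, C, hC, hiC, hjC, rfl⟩ hd
    rw [disjoint_left] at hd
    have hiA : i ∉ A := fun h => hd h hiB
    by_cases hjA : j ∈ A
    · refine hF _ (hA' hiA hjA) C hC (disjoint_left.2 fun x hx hxC => ?_)
      rcases mem_insert.1 hx with rfl | hx
      · exact hiC hxC
      · obtain ⟨hxj, hxA⟩ := mem_erase.1 hx
        exact hd hxA (mem_insert_of_mem (mem_erase.2 ⟨hxj, hxC⟩))
    · refine hF A hA C hC (disjoint_left.2 fun x hx hxC => ?_)
      exact hd hx (mem_insert_of_mem (mem_erase.2 ⟨fun h => hjA (h ▸ hx), hxC⟩))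
  intro A hA B hB
  rcases shift_cases hA with h | h <;> rcases shift_cases hB with h' | h'
  · exact hF A h.1 B h'.1
  · exact key A B h h'
  · exact fun hd => key B A h' h hd.symm
  · exact fun hd => disjoint_left.1 hd h.1 h'.1

/-- The only element a shift can add is `i`, so sets missing any other vertex still miss it. -/
theorem card_filter_notMem_le_shift {x : ℕ} (hx : x ≠ i) :
    #(F.filter fun A => x ∉ A) ≤ #((shift i j F).filter fun A => x ∉ A) := by
  refine card_le_card_of_injOn (shiftMap i j F) (fun A hA => ?_)
    (shiftMap_injOn.mono fun A hA => (mem_filter.1 hA).1)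
  rw [mem_coe, mem_filter] at hA ⊢
  refine ⟨mem_image_of_mem _ hA.1, fun h => ?_⟩
  rcases mem_insert.1 (shiftMap_subset A h) with h | h
  · exact hx h
  · exact hA.2 h

/-- The decreasing measure that makes repeated shifting terminate. -/
theorem sum_shift_lt (hij : i < j) {A : Finset ℕ} (hA : A ∈ F) (hi : i ∉ A) (hj : j ∈ A)
    (hAF : insert i (A.erase j) ∉ F) :
    ∑ B ∈ shift i j F, ∑ x ∈ B, x < ∑ B ∈ F, ∑ x ∈ B, x := by
  have key : ∀ B : Finset ℕ, i ∉ B → j ∈ B → ∑ x ∈ insert i (B.erase j), x < ∑ x ∈ B, x := by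
    intro B hiB hjB
    rw [sum_insert (fun h => hiB (mem_of_mem_erase h)), ← add_sum_erase B _ hjB]
    omega
  rw [shift, sum_image shiftMap_injOn]
  refine sum_lt_sum (fun B _ => ?_) ⟨A, hA, ?_⟩
  · unfold shiftMap
    split_ifs with h
    · exact (key B h.1 h.2.1).le
    · exact le_rfl
  · rw [shiftMap, if_pos ⟨hi, hj, hAF⟩]
    exact key A hi hj

end Shift

/-- Katona's shadow theorem for shifted intersecting families. -/
theorem card_le_card_shadow_of_shifted {S : Finset ℕ} : ∀ {a : ℕ} {A E : Finset (Finset ℕ)},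
    A ⊆ powersetCard a S → Shifted S A → (∀ B ∈ A, ∀ C ∈ A, ¬ Disjoint B C) →
    (∀ B ∈ A, ∀ x ∈ B, B.erase x ∈ E) → #A ≤ #E := by
  induction S using Finset.induction_on_max with
  | empty =>
    intro a A E hA _ hint _
    rcases A.eq_empty_or_nonempty with rfl | ⟨B, hB⟩
    · simp
    · have := subset_empty.1 (mem_powersetCard.1 (hA hB)).1
      exact absurd (this ▸ disjoint_empty_left B) (hint B hB B hB)
  | insert p S hp ih =>
    intro a A E hA hsh hint hE
    have hpS : p ∉ S := fun h => lt_irrefl _ (hp p h)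
    rcases A.eq_empty_or_nonempty with rfl | ⟨B₀, hB₀⟩
    · simp
    have ha : 1 ≤ a := by
      by_contra! h
      have h0 := (mem_powersetCard.1 (hA hB₀)).2
      rw [Nat.lt_one_iff.1 h, card_eq_zero] at h0
      exact hint B₀ hB₀ B₀ hB₀ (h0 ▸ disjoint_empty_left _)
    -- For large `a`, each (a-1)-set has at most `a` extensions, so double counting suffices.
    -- Otherwise the family is split at the largest point `p`.
    rcases le_or_gt (#S + 2) (2 * a) with hle | hlt
    · have := card_mul_choose_le_card_mul_choose (l := a - 1) hA (E := E) (fun B hB T hTB hT => by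
        have hBc := (mem_powersetCard.1 (hA hB)).2
        have h1 : #(B \ T) = 1 := by rw [card_sdiff_of_subset hTB]; omega
        obtain ⟨x, hx⟩ := card_eq_one.1 h1
        have hxB : x ∈ B := (mem_sdiff.1 (hx ▸ mem_singleton_self x)).1
        have : T = B.erase x := by
          rw [← sdiff_singleton_eq_erase, ← hx, Finset.sdiff_sdiff_eq_self hTB]
        exact this ▸ hE B hB x hxB)
      rw [card_insert_of_notMem hpS, Nat.choose_symm (by omega : 1 ≤ a) |>.trans (Nat.choose_one_right a),
        show a - (a - 1) = 1 by omega, Nat.choose_one_right] at this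
      exact Nat.le_of_mul_le_mul_right (this.trans (Nat.mul_le_mul_left _ (by omega))) ha
    rw [← card_memberSubfamily_add_card_nonMemberSubfamily p A,
      ← card_memberSubfamily_add_card_nonMemberSubfamily p E]
    have hsub : ∀ B ⊆ insert p S, p ∉ B → B ⊆ S := fun B hB hpB x hx => by
      rcases mem_insert.1 (hB hx) with rfl | h
      · exact absurd hx hpB
      · exact h
    refine add_le_add (ih (a := a - 1) ?_ ?_ ?_ ?_) (ih (a := a) ?_ ?_ ?_ ?_)
    · intro B hB
      rw [mem_memberSubfamily] at hB
      have := mem_powersetCard.1 (hA hB.1)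
      rw [card_insert_of_notMem hB.2] at this
      exact mem_powersetCard.2 ⟨hsub B ((subset_insert _ _).trans this.1) hB.2, by omega⟩
    · intro i hi j hj hij B hB hiB hjB
      rw [mem_memberSubfamily] at hB ⊢
      have hip := hp i hi
      have hjp := hp j hj
      have := hsh i (mem_insert_of_mem hi) j (mem_insert_of_mem hj) hij _ hB.1
        (by simp [hiB, hip.ne]) (by simp [hjB])
      rw [erase_insert_of_ne hjp.ne', insert_comm] at this
      exact ⟨this, by simp [hip.ne', hB.2]⟩
    · intro B hB C hC hd
      rw [mem_memberSubfamily] at hB hC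
      have h1 := mem_powersetCard.1 (hA hB.1)
      have h2 := mem_powersetCard.1 (hA hC.1)
      rw [card_insert_of_notMem hB.2] at h1
      rw [card_insert_of_notMem hC.2] at h2
      -- Some `y` lies outside both traces; if they were disjoint, shifting `p` to `y` in one member
      -- would make two members disjoint.
      have hcard : #(B ∪ C) < #S := by
        have := card_union_le B C
        omega
      obtain ⟨y, hy, hyBC⟩ := exists_mem_notMem_of_card_lt_card hcard
      rw [mem_union, not_or] at hyBC
      have hyp := hp y hy
      have := hsh y (mem_insert_of_mem hy) p (mem_insert_self _ _) hyp _ hB.1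
        (by simp [hyBC.1, hyp.ne]) (mem_insert_self _ _)
      rw [erase_insert hB.2] at this
      refine hint _ this _ hC.1 ?_
      rw [disjoint_insert_left, disjoint_insert_right]
      exact ⟨by simp [hyBC.2, hyp.ne], hB.2, hd⟩
    · intro B hB x hx
      rw [mem_memberSubfamily] at hB ⊢
      have hxp : x ≠ p := fun h => hB.2 (h ▸ hx)
      rw [← erase_insert_of_ne hxp.symm]
      exact ⟨hE _ hB.1 x (mem_insert_of_mem hx), fun h => hB.2 (mem_of_mem_erase h)⟩
    · intro B hB
      rw [mem_nonMemberSubfamily] at hB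
      have := mem_powersetCard.1 (hA hB.1)
      exact mem_powersetCard.2 ⟨hsub B this.1 hB.2, this.2⟩
    · intro i hi j hj hij B hB hiB hjB
      rw [mem_nonMemberSubfamily] at hB ⊢
      exact ⟨hsh i (mem_insert_of_mem hi) j (mem_insert_of_mem hj) hij B hB.1 hiB hjB,
        by simp [(hp i hi).ne', hB.2]⟩
    · intro B hB C hC
      rw [mem_nonMemberSubfamily] at hB hC
      exact hint B hB.1 C hC.1
    · intro B hB x hx
      rw [mem_nonMemberSubfamily] at hB ⊢
      exact ⟨hE B hB.1 x hx, fun h => hB.2 (mem_of_mem_erase h)⟩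

/-! ### Links -/

/-- The sets `A \ I`, where `A` is a member of `F` that contains `I` and avoids `J`. -/
def link (F : Finset (Finset ℕ)) (I J : Finset ℕ) : Finset (Finset ℕ) :=
  (F.filter fun A => I ⊆ A ∧ Disjoint A J).image fun A => A \ I

section Link

variable {F : Finset (Finset ℕ)} {I J : Finset ℕ}

theorem mem_link (hIJ : Disjoint I J) {B : Finset ℕ} :
    B ∈ link F I J ↔ Disjoint B I ∧ Disjoint B J ∧ B ∪ I ∈ F := by
  simp only [link, mem_image, mem_filter]
  constructor
  · rintro ⟨A, ⟨hA, hIA, hAJ⟩, rfl⟩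
    exact ⟨sdiff_disjoint, hAJ.mono_left sdiff_subset, by rwa [sdiff_union_of_subset hIA]⟩
  · rintro ⟨h1, h2, h3⟩
    refine ⟨B ∪ I, ⟨h3, subset_union_right, disjoint_union_left.2 ⟨h2, hIJ⟩⟩, ?_⟩
    rw [union_sdiff_right, sdiff_eq_self_of_disjoint h1]

theorem card_link : #(link F I J) = #(F.filter fun A => I ⊆ A ∧ Disjoint A J) := by
  refine card_image_of_injOn fun A hA B hB h => ?_
  rw [mem_coe, mem_filter] at hA hB
  rw [← sdiff_union_of_subset hA.2.1, ← sdiff_union_of_subset hB.2.1]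
  exact congrArg (· ∪ I) h

theorem card_link_split {x : ℕ} (F : Finset (Finset ℕ)) (I J : Finset ℕ) :
    #(link F I J) = #(link F (insert x I) J) + #(link F I (insert x J)) := by
  simp only [card_link]
  rw [← card_filter_add_card_filter_not (fun A : Finset ℕ => x ∈ A), filter_filter, filter_filter]
  congr 2 <;> ext A <;> simp only [mem_filter, insert_subset_iff, disjoint_insert_right] <;> tauto

theorem card_link_empty : #(link F ∅ ∅) = #F := by simp [card_link]

theorem card_link_singleton (x : ℕ) : #(link F ∅ {x}) = #(F.filter fun A => x ∉ A) := by
  simp [card_link]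

theorem link_subset {k : ℕ} {S : Finset ℕ} (hF : F ⊆ powersetCard k S) :
    link F I J ⊆ powersetCard (k - #I) (S \ (I ∪ J)) := by
  intro B hB
  simp only [link, mem_image, mem_filter] at hB
  obtain ⟨A, ⟨hA, hIA, hAJ⟩, rfl⟩ := hB
  have := mem_powersetCard.1 (hF hA)
  refine mem_powersetCard.2 ⟨fun x hx => ?_, by rw [card_sdiff_of_subset hIA, this.2]⟩
  rw [mem_sdiff] at hx
  rw [mem_sdiff, mem_union, not_or]
  exact ⟨this.1 hx.1, hx.2, disjoint_left.1 hAJ hx.1⟩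

theorem link_cross_intersecting {I' J' : Finset ℕ} (hF : ∀ A ∈ F, ∀ B ∈ F, ¬ Disjoint A B)
    (hIJ : Disjoint I J) (hIJ' : Disjoint I' J') (hI : Disjoint I I') (h1 : I' ⊆ J)
    (h2 : I ⊆ J') :
    ∀ a ∈ link F I J, ∀ b ∈ link F I' J', ¬ Disjoint a b := by
  intro a ha b hb hd
  rw [mem_link hIJ] at ha
  rw [mem_link hIJ'] at hb
  refine hF _ ha.2.2 _ hb.2.2 ?_
  rw [disjoint_union_left, disjoint_union_right, disjoint_union_right]
  exact ⟨⟨hd, ha.2.1.mono_right h1⟩, (hb.2.1.mono_right h2).symm, hI⟩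

theorem link_shifted {S S' : Finset ℕ} (hF : Shifted S F) (hIJ : Disjoint I J) (hS : S' ⊆ S)
    (hI : Disjoint S' I) (hJ : Disjoint S' J) : Shifted S' (link F I J) := by
  intro i hi j hj hij B hB hiB hjB
  rw [mem_link hIJ] at hB ⊢
  have hiI := disjoint_left.1 hI hi
  have hjI := disjoint_left.1 hI hj
  have hiJ := disjoint_left.1 hJ hi
  have := hF i (hS hi) j (hS hj) hij _ hB.2.2 (by simp [hiB, hiI]) (by simp [hjB])
  rw [erase_union_distrib, erase_eq_of_notMem hjI, ← insert_union] at this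
  refine ⟨disjoint_insert_left.2 ⟨hiI, hB.1.mono_left (erase_subset _ _)⟩,
    disjoint_insert_left.2 ⟨hiJ, hB.2.1.mono_left (erase_subset _ _)⟩, this⟩

end Link

/-! ### Diversity of large intersecting families

Throughout this section `n = k + q + 4` and the families consist of `(k + 2)`-sets. -/

section Diversity

variable {k q : ℕ} {F : Finset (Finset ℕ)}

theorem link_subset_of_card {n r : ℕ} {I J U : Finset ℕ} (hF : F ⊆ powersetCard n U)
    {S : Finset ℕ} (hS : S = U \ (I ∪ J)) (hr : r + #I = n) :
    link F I J ⊆ powersetCard r S := by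
  rw [hS, show r = n - #I by omega]
  exact link_subset hF

/-- A vertex missed by few members of a large intersecting family is missed by very few. -/
theorem card_notMem_le_of_le (hq : k + 4 ≤ q)
    (hF : F ⊆ powersetCard (k + 2) (Icc 1 (k + q + 4)))
    (hint : ∀ A ∈ F, ∀ B ∈ F, ¬ Disjoint A B)
    (hcard : 2 * (k + q + 1).choose k + (k + q + 2).choose k < #F) {x : ℕ}
    (hx : x ∈ Icc 1 (k + q + 4)) (hle : #(link F ∅ {x}) ≤ (k + q + 1).choose k) :
    #(link F ∅ {x}) ≤ (k + q).choose (q + 1) := by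
  by_contra! hlt
  have hS : #(Icc 1 (k + q + 4) \ {x}) = k + q + 3 := by
    rw [card_sdiff_of_subset (singleton_subset_iff.2 hx), Nat.card_Icc, card_singleton]
    omega
  have hA : link F {x} ∅ ⊆ powersetCard (k + 1) (Icc 1 (k + q + 4) \ {x}) :=
    link_subset_of_card hF (by simp) (by simp)
  have hB : link F ∅ {x} ⊆ powersetCard (k + 2) (Icc 1 (k + q + 4) \ {x}) :=
    link_subset_of_card hF (by simp) (by simp)
  obtain ⟨E, hE, hAE⟩ := exists_disjoint_cover hS hA
    (link_cross_intersecting hint (disjoint_empty_right _) (disjoint_empty_left _)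
      (disjoint_empty_right _) (empty_subset _) le_rfl : ∀ a ∈ link F {x} ∅,
        ∀ b ∈ link F ∅ {x}, ¬ Disjoint a b)
  have e1 : (k + q + 1).choose (q + 1) = (k + q + 1).choose k :=
    Nat.choose_symm_of_eq_add (by omega)
  have e2 : (k + q).choose q = (k + q).choose k := Nat.choose_symm_of_eq_add (by omega)
  -- Here N = n-4. The excess bound and Pascal's rule give #F ≤ 2·C(n-3,k) + C(n-2,k), against
  -- `hcard`.
  have h := card_add_choose_le_of_disjoint (N := k + q) hS hB hE (by omega) (by omega) (by omega)
    (by omega) (by rwa [show k + q + 3 - (k + 2) = q + 1 by omega])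
    (by rwa [show k + q + 3 - (k + 2) = q + 1 by omega, e1])
  rw [show k + q + 3 - (k + 2) = q + 1 by omega] at h
  have hsum := card_link_split (x := x) F ∅ ∅
  rw [card_link_empty, insert_empty_eq] at hsum
  have p1 : (k + q + 3).choose (k + 1) =
      (k + q + 2).choose k + (k + q + 2).choose (k + 1) := Nat.choose_succ_succ _ _
  have p2 : (k + q + 2).choose (k + 1) =
      (k + q + 1).choose k + (k + q + 1).choose (k + 1) := Nat.choose_succ_succ _ _
  have p3 : (k + q + 1).choose (k + 1) =
      (k + q).choose k + (k + q).choose (k + 1) := Nat.choose_succ_succ _ _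
  have p4 : (k + q + 1).choose (q + 1) =
      (k + q).choose q + (k + q).choose (q + 1) := Nat.choose_succ_succ _ _
  omega

/-- Cross-intersecting families of `(k + 1)`-sets, neither of which is small. -/
theorem card_add_card_le_of_cross_intersecting (hq : k + 4 ≤ q) {S : Finset ℕ}
    (hS : #S = k + q + 2) {A B : Finset (Finset ℕ)} (hA : A ⊆ powersetCard (k + 1) S)
    (hB : B ⊆ powersetCard (k + 1) S) (hAB : ∀ a ∈ A, ∀ b ∈ B, ¬ Disjoint a b)
    (hA' : (k + q).choose (q + 1) < #A) (hB' : (k + q).choose (q + 1) < #B) :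
    #A + #B ≤ 2 * (k + q + 1).choose k := by
  have e1 : (k + q + 1).choose (q + 1) = (k + q + 1).choose k :=
    Nat.choose_symm_of_eq_add (by omega)
  have e2 : (k + q).choose q = (k + q).choose k := Nat.choose_symm_of_eq_add (by omega)
  have p2 : (k + q + 2).choose (k + 1) =
      (k + q + 1).choose k + (k + q + 1).choose (k + 1) := Nat.choose_succ_succ _ _
  have p3 : (k + q + 1).choose (k + 1) =
      (k + q).choose k + (k + q).choose (k + 1) := Nat.choose_succ_succ _ _
  have p4 : (k + q + 1).choose (q + 1) =
      (k + q).choose q + (k + q).choose (q + 1) := Nat.choose_succ_succ _ _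
  have ee : k + q + 2 - (k + 1) = q + 1 := by omega
  wlog hle : #B ≤ (k + q + 1).choose k generalizing A B
  · by_cases hle' : #A ≤ (k + q + 1).choose k
    · rw [add_comm]
      exact this hB hA (fun b hb a ha h => hAB a ha b hb h.symm) hB' hA' hle'
    obtain ⟨E, hE, hAE⟩ := exists_disjoint_cover hS hA hAB
    have h := choose_le_card_of_disjoint (N := k + q + 1) hS hB hE (by omega) (by omega) (by omega)
      (by rw [ee]; omega)
    omega
  obtain ⟨E, hE, hAE⟩ := exists_disjoint_cover hS hA hAB
  have h := card_add_choose_le_of_disjoint (N := k + q) hS hB hE (by omega) (by omega) (by omega)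
    (by omega) (by rwa [ee]) (by rwa [ee, e1])
  rw [ee] at h
  omega

theorem choose_succ_le_choose (hq : k + 4 ≤ q) : (k + q).choose (q + 1) ≤ (k + q).choose k := by
  rcases Nat.eq_zero_or_pos k with rfl | hk
  · simp
  rw [Nat.choose_symm_of_eq_add (show k + q = q + 1 + (k - 1) by omega)]
  have := Nat.choose_le_succ_of_lt_half_left (show k - 1 < (k + q) / 2 by omega)
  rwa [Nat.sub_add_cancel hk] at this

/-- In a large intersecting family without a vertex missed by few members, every shift leaves
every vertex missed by many members. -/
theorem lt_card_notMem_shift (hq : k + 4 ≤ q)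
    (hF : F ⊆ powersetCard (k + 2) (Icc 1 (k + q + 4)))
    (hint : ∀ A ∈ F, ∀ B ∈ F, ¬ Disjoint A B)
    (hcard : 2 * (k + q + 1).choose k + (k + q + 2).choose k < #F)
    (hdiv : ∀ x ∈ Icc 1 (k + q + 4), (k + q + 1).choose k < #(link F ∅ {x}))
    {i j : ℕ} (hi : i ∈ Icc 1 (k + q + 4)) (hj : j ∈ Icc 1 (k + q + 4)) (hij : i ≠ j) :
    ∀ x ∈ Icc 1 (k + q + 4), (k + q + 1).choose k < #(link (shift i j F) ∅ {x}) := by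
  intro x hx
  rcases ne_or_eq x i with hxi | rfl
  · refine (hdiv x hx).trans_le ?_
    rw [card_link_singleton, card_link_singleton]
    exact card_filter_notMem_le_shift hxi
  by_contra! hle
  have h1 := card_notMem_le_of_le hq (shift_subset hF hx) (shift_intersecting hij hint)
    (by rwa [card_shift]) hx hle
  -- Members avoiding both vertices survive the shift, so there are at most C(n-4,k-1) of them.
  have h0 : #(link F ∅ {x, j}) ≤ #(link (shift x j F) ∅ {x}) := by
    rw [card_link, card_link]
    refine card_le_card fun A hA => ?_
    simp only [mem_filter, disjoint_insert_right, disjoint_singleton_right] at hA ⊢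
    exact ⟨mem_shift_of_notMem hA.1 hA.2.2.2, hA.2.1, hA.2.2.1⟩
  have hS : #(Icc 1 (k + q + 4) \ {x, j}) = k + q + 2 := by
    rw [card_sdiff_of_subset (insert_subset hx (singleton_subset_iff.2 hj)), Nat.card_Icc,
      card_pair hij]
    omega
  have s0 := card_link_split (x := x) F ∅ ∅
  have s1 := card_link_split (x := j) F {x} ∅
  have s2 := card_link_split (x := j) F ∅ {x}
  have s3 := card_link_split (x := x) F ∅ {j}
  rw [card_link_empty] at s0
  simp only [insert_empty_eq, pair_comm j x] at s0 s1 s2 s3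
  have d1 := hdiv x hx
  have d2 := hdiv j hj
  have hAB : ∀ a ∈ link F {x} {j}, ∀ b ∈ link F {j} {x}, ¬ Disjoint a b :=
    link_cross_intersecting hint (by simpa using hij) (by simpa using hij.symm)
      (by simpa using hij) le_rfl le_rfl
  have hpair : #({x, j} : Finset ℕ) = 2 := card_pair hij
  have hAB' : ∀ a ∈ link F {x, j} ∅, ∀ b ∈ link F ∅ {x, j}, ¬ Disjoint a b :=
    link_cross_intersecting hint (disjoint_empty_right _) (disjoint_empty_left _)
      (disjoint_empty_right _) (empty_subset _) le_rfl
  obtain ⟨E, hE, hAE⟩ := exists_disjoint_cover (s := k) hS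
    (link_subset_of_card hF (by simp) (by omega)) hAB'
  have e2 : (k + q).choose q = (k + q).choose k := Nat.choose_symm_of_eq_add (by omega)
  have hle2 := choose_succ_le_choose hq
  -- With N = n-4 both binomial factors equal C(q,k), so the links containing both vertices and
  -- neither vertex have total size at most C(n-2,k).
  have h2 := card_mul_choose_le_of_disjoint (N := k + q) (r := k + 2) hS
    (link_subset_of_card hF (by simp) (by simp)) hE (by omega) (by omega) (by
      rw [show k + q + 2 - (k + 2) = q by omega, e2]
      omega)
  rw [show k + q + 2 - (k + 2) = q by omega, show k + q - k = q by omega,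
    Nat.choose_symm (by omega : k ≤ q)] at h2
  have h3 := Nat.le_of_mul_le_mul_right h2 (Nat.choose_pos (by omega))
  have e1 : (k + q + 1).choose (q + 1) = (k + q + 1).choose k :=
    Nat.choose_symm_of_eq_add (by omega)
  have p4 : (k + q + 1).choose (q + 1) =
      (k + q).choose q + (k + q).choose (q + 1) := Nat.choose_succ_succ _ _
  have hpos : 0 < (k + q).choose k := Nat.choose_pos (by omega)
  have h4 := card_add_card_le_of_cross_intersecting hq hS
    (link_subset_of_card hF rfl (by simp))
    (link_subset_of_card hF (by rw [pair_comm]; rfl) (by simp)) hAB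
    (by omega) (by omega)
  omega

/-- In a shifted intersecting family few members miss the first vertex. -/
theorem card_notMem_one_le_of_shifted (hq : 35 * k + 8 ≤ q)
    (hF : F ⊆ powersetCard (k + 2) (Icc 1 (k + q + 4)))
    (hint : ∀ A ∈ F, ∀ B ∈ F, ¬ Disjoint A B) (hsh : Shifted (Icc 1 (k + q + 4)) F) :
    #(link F ∅ {1}) ≤ (k + q + 1).choose k := by
  have hmem : ∀ {x}, x ∈ Icc 1 (k + q + 4) ↔ 1 ≤ x ∧ x ≤ k + q + 4 := mem_Icc
  have s1 := card_link_split (x := 2) F ∅ {1}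
  have s2 := card_link_split (x := 3) F {2} {1}
  have s3 := card_link_split (x := 3) F ∅ {2, 1}
  have s4 := card_link_split (x := 4) F {2} {3, 1}
  simp only [insert_empty_eq] at s1 s2 s3 s4
  have hS3 : #(Icc 4 (k + q + 4)) = k + q + 1 := by rw [Nat.card_Icc]; omega
  have hS4 : #(Icc 5 (k + q + 4)) = k + q := by rw [Nat.card_Icc]; omega
  have c32 : #(link F {3} {2, 1}) ≤ #(link F {2} {3, 1}) := by
    refine card_le_card fun B hB => ?_
    rw [mem_link (by simp)] at hB ⊢
    simp only [disjoint_singleton_right, disjoint_insert_right] at hB ⊢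
    have := hsh 2 (hmem.2 (by omega)) 3 (hmem.2 (by omega)) (by omega) _ hB.2.2
      (by simp [hB.2.1]) (by simp)
    rw [erase_union_distrib, erase_eq_of_notMem hB.1] at this
    simp at this
    refine ⟨hB.2.1.1, ⟨hB.1, hB.2.1.2⟩, ?_⟩
    rwa [union_singleton]
  -- Shifting any element to 3 puts the whole shadow of the left link into the right one, so
  -- Katona's theorem applies. The bound `cQP` uses 4 in the same way.
  have c03 : #(link F ∅ {3, 2, 1}) ≤ #(link F {3} {2, 1}) := by
    refine card_le_card_shadow_of_shifted (S := Icc 4 (k + q + 4)) (a := k + 2)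
      (link_subset_of_card hF ?_ (by simp))
      (link_shifted hsh (disjoint_empty_left _) ?_ (disjoint_empty_right _) ?_) ?_ ?_
    · ext x; simp; omega
    · intro x; simp; omega
    · rw [disjoint_left]; intro x; simp; omega
    · intro B hB C hC
      rw [mem_link (disjoint_empty_left _), union_empty] at hB hC
      exact hint B hB.2.2 C hC.2.2
    · intro B hB x hx
      rw [mem_link (disjoint_empty_left _), union_empty] at hB
      rw [mem_link (by simp)]
      have hx3 : x ∉ ({3, 2, 1} : Finset ℕ) := disjoint_left.1 hB.2.1 hx
      have hxI := hmem.1 ((mem_powersetCard.1 (hF hB.2.2)).1 hx)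
      simp only [disjoint_singleton_right, disjoint_insert_right, mem_insert, mem_singleton,
        not_or] at hB hx3 ⊢
      have := hsh 3 (hmem.2 (by omega)) x (hmem.2 hxI) (by omega) _ hB.2.2 hB.2.1.1 hx
      refine ⟨fun h => hB.2.1.1 (mem_of_mem_erase h), ⟨fun h => hB.2.1.2.1 (mem_of_mem_erase h),
        fun h => hB.2.1.2.2 (mem_of_mem_erase h)⟩, ?_⟩
      rwa [union_singleton]
  have cQP : #(link F {2} {4, 3, 1}) ≤ #(link F {4, 2} {3, 1}) := by
    refine card_le_card_shadow_of_shifted (S := Icc 5 (k + q + 4)) (a := k + 1)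
      (link_subset_of_card hF ?_ (by simp))
      (link_shifted hsh (by simp) ?_ ?_ ?_) ?_ ?_
    · ext x; simp; omega
    · intro x; simp; omega
    · rw [disjoint_left]; intro x; simp; omega
    · rw [disjoint_left]; intro x; simp; omega
    -- Shifting 2 to 1 in one member removes the common point 2, so the traces themselves must meet.
    · intro B hB C hC hd
      rw [mem_link (by simp)] at hB hC
      simp only [disjoint_singleton_right, disjoint_insert_right] at hB hC
      have := hsh 1 (hmem.2 (by omega)) 2 (hmem.2 (by omega)) (by omega) _ hB.2.2
        (by simp [hB.2.1]) (by simp)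
      rw [erase_union_distrib, erase_eq_of_notMem hB.1] at this
      refine hint _ this _ hC.2.2 ?_
      simp [hB, hC, hd]
    · intro B hB x hx
      rw [mem_link (by simp)] at hB ⊢
      have hx3 : x ∉ ({4, 3, 1} : Finset ℕ) := disjoint_left.1 hB.2.1 hx
      have hx2 : x ∉ ({2} : Finset ℕ) := disjoint_left.1 hB.1 hx
      have hxI := hmem.1 ((mem_powersetCard.1 (hF hB.2.2)).1 (mem_union_left _ hx))
      simp only [disjoint_singleton_right, disjoint_insert_right, mem_insert, mem_singleton,
        not_or] at hB hx3 hx2 ⊢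
      have := hsh 4 (hmem.2 (by omega)) x (hmem.2 hxI) (by omega) _ hB.2.2
        (by simp [hB.2.1]) (mem_union_left _ hx)
      rw [erase_union_distrib, erase_eq_of_notMem (a := x) (s := {2}) (by simp [hx2])] at this
      simp only [mem_erase, hB, and_false, not_false_eq_true, true_and]
      rwa [union_insert]
  have hPsub : link F {4, 2} {3, 1} ⊆ powersetCard k (Icc 5 (k + q + 4)) :=
    link_subset_of_card hF (by ext x; simp; omega) (by simp)
  -- Shifting yields B ∪ {1,4} and C ∪ {2,3}, whose added parts are disjoint.
  have hPint : ∀ B ∈ link F {4, 2} {3, 1}, ∀ C ∈ link F {4, 2} {3, 1}, ¬ Disjoint B C := by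
    intro B hB C hC hd
    rw [mem_link (by decide)] at hB hC
    simp only [disjoint_singleton_right, disjoint_insert_right] at hB hC
    have h1 := hsh 1 (hmem.2 (by omega)) 2 (hmem.2 (by omega)) (by omega) _ hB.2.2
      (by simp [hB.2.1]) (by simp)
    have h2 := hsh 3 (hmem.2 (by omega)) 4 (hmem.2 (by omega)) (by omega) _ hC.2.2
      (by simp [hC.2.1]) (by simp)
    rw [erase_union_distrib, erase_eq_of_notMem hB.1.2] at h1
    rw [erase_union_distrib, erase_eq_of_notMem hC.1.1] at h2
    refine hint _ h1 _ h2 ?_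
    rw [show ({4, 2} : Finset ℕ).erase 2 = {4} by decide,
      show ({4, 2} : Finset ℕ).erase 4 = {2} by decide]
    simp [hB, hC, hd]
  have hP := card_le_choose_of_intersecting hS4 hPsub hPint (by omega)
  rw [show k + q - k = q by omega] at hP
  have hcross : ∀ a ∈ link F {3, 2} {1}, ∀ b ∈ (link F {4, 2} {3, 1}).image (insert 4),
      ¬ Disjoint a b := by
    intro a ha b hb hd
    obtain ⟨B, hB, rfl⟩ := mem_image.1 hb
    rw [mem_link (by decide)] at ha hB
    simp only [disjoint_singleton_right, disjoint_insert_right] at ha hB hd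
    have h1 := hsh 1 (hmem.2 (by omega)) 2 (hmem.2 (by omega)) (by omega) _ hB.2.2
      (by simp [hB.2.1]) (by simp)
    rw [erase_union_distrib, erase_eq_of_notMem hB.1.2,
      show ({4, 2} : Finset ℕ).erase 2 = {4} by decide] at h1
    refine hint _ h1 _ ha.2.2 ?_
    simp [ha, hB, hd, hd.2.symm]
  have h4 : ∀ B ∈ link F {4, 2} {3, 1}, 4 ∉ B := fun B hB h => by
    simpa using (mem_powersetCard.1 (hPsub hB)).1 h
  have hLcard : #((link F {4, 2} {3, 1}).image (insert 4)) = #(link F {4, 2} {3, 1}) := by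
    refine card_image_of_injOn fun B hB C hC h => ?_
    have hB' := h4 B hB
    have hC' := h4 C hC
    rw [← erase_insert hB', ← erase_insert hC']
    exact congrArg (·.erase 4) h
  have hLsub : (link F {4, 2} {3, 1}).image (insert 4) ⊆
      powersetCard (k + 1) (Icc 4 (k + q + 4)) := by
    intro b hb
    obtain ⟨B, hB, rfl⟩ := mem_image.1 hb
    have hB' := h4 B hB
    have := mem_powersetCard.1 (hPsub hB)
    refine mem_powersetCard.2 ⟨insert_subset (by simp) (this.1.trans ?_), ?_⟩
    · exact Icc_subset_Icc_left (by omega)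
    · rw [card_insert_of_notMem hB', this.2]
  obtain ⟨E, hE, hAE⟩ := exists_disjoint_cover (s := k) hS3
    (link_subset_of_card hF (by ext x; simp; omega) (by simp)) hcross
  -- This N is exactly the one allowed by the Erdős–Ko–Rado bound `hP`; it yields an expansion
  -- factor q/k.
  have h := card_mul_choose_le_of_disjoint (N := k + q - 1) hS3 hLsub hE (by omega) (by omega)
    (by rwa [hLcard, show k + q + 1 - (k + 1) = q by omega])
  rw [hLcard, show k + q + 1 - (k + 1) = q by omega] at h
  have hfin : 6 * #(link F {4, 2} {3, 1}) ≤ #E := by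
    rcases Nat.eq_zero_or_pos k with rfl | hk
    · rw [Nat.choose_eq_zero_of_lt (by omega)] at hP
      omega
    rw [show k + q - 1 - k = q - 1 by omega,
      Nat.choose_symm_of_eq_add (show q - 1 = (q - k) + (k - 1) by omega)] at h
    have hpos : 0 < (q - 1).choose (k - 1) := Nat.choose_pos (by omega)
    have habs := Nat.add_one_mul_choose_eq (q - 1) (k - 1)
    rw [Nat.sub_add_cancel hk, Nat.sub_add_cancel (by omega : 1 ≤ q)] at habs
    refine Nat.le_of_mul_le_mul_right (c := (q - 1).choose (k - 1) * k) ?_ (by positivity)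
    calc 6 * #(link F {4, 2} {3, 1}) * ((q - 1).choose (k - 1) * k)
        = #(link F {4, 2} {3, 1}) * (6 * k * (q - 1).choose (k - 1)) := by ring
      _ ≤ #(link F {4, 2} {3, 1}) * (q * (q - 1).choose (k - 1)) := by gcongr; omega
      _ = #(link F {4, 2} {3, 1}) * q.choose k * k := by rw [habs]; ring
      _ ≤ #E * (q - 1).choose (k - 1) * k := by gcongr
      _ = #E * ((q - 1).choose (k - 1) * k) := by ring
  -- The shadow bounds give #F(¬1) ≤ #F(2,3,¬1) + 3·#F(2,¬1,¬3) ≤ #F(2,3,¬1) + 6·#F(2,4,¬1,¬3), and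
  -- `hfin` absorbs the last term into #E.
  omega

/-- A large intersecting family has a vertex missed by at most `C(n - 3, k)` members. -/
theorem exists_card_notMem_le (hq : 35 * k + 8 ≤ q) : ∀ F : Finset (Finset ℕ),
    F ⊆ powersetCard (k + 2) (Icc 1 (k + q + 4)) →
    (∀ A ∈ F, ∀ B ∈ F, ¬ Disjoint A B) →
    2 * (k + q + 1).choose k + (k + q + 2).choose k < #F →
    ∃ x ∈ Icc 1 (k + q + 4), #(link F ∅ {x}) ≤ (k + q + 1).choose k := by
  intro F
  -- A shift that changes the family lowers this sum and turns a counterexample into another, so a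
  -- minimal counterexample is shifted.
  induction hw : ∑ B ∈ F, ∑ x ∈ B, x using Nat.strong_induction_on generalizing F with
  | _ w ih =>
  intro hF hint hcard
  by_contra! hdiv
  by_cases hsh : Shifted (Icc 1 (k + q + 4)) F
  · exact (card_notMem_one_le_of_shifted hq hF hint hsh).not_gt (hdiv 1 (by simp))
  · unfold Shifted at hsh
    push Not at hsh
    obtain ⟨i, hi, j, hj, hij, A, hA, hiA, hjA, hAF⟩ := hsh
    obtain ⟨x, hx, hx'⟩ := ih _ (hw ▸ sum_shift_lt hij hA hiA hjA hAF) (shift i j F) rfl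
      (shift_subset hF hi) (shift_intersecting hij.ne hint) (by rwa [card_shift])
    exact hx'.not_gt
      (lt_card_notMem_shift (by omega) hF hint hcard hdiv hi hj hij.ne x hx)

end Diversity

/-! ### From the gap to the degree ratio -/

/-- A lower bound for the size of the two-out-of-three family. -/
theorem le_card_frankl_three (k q : ℕ) :
    2 * (k + q + 1).choose k + (k + q + 2).choose k ≤ #(frankl (k + q + 4) (k + 2) 3) := by
  set G := frankl (k + q + 4) (k + 2) 3 with hG
  have hmemG : ∀ A : Finset ℕ, A ∈ G ↔ (A ⊆ Icc 1 (k + q + 4) ∧ #A = k + 2) ∧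
      ((1 ∈ A ∧ (2 ∈ A ∨ 3 ∈ A)) ∨ (2 ∈ A ∧ 3 ∈ A)) := by
    intro A
    have h23 : Icc 2 3 = ({2, 3} : Finset ℕ) := by decide
    have hne : (A ∩ {2, 3}).Nonempty ↔ 2 ∈ A ∨ 3 ∈ A := by
      simp only [Finset.Nonempty, mem_inter, mem_insert, mem_singleton]
      constructor
      · rintro ⟨x, hx, rfl | rfl⟩ <;> simp [hx]
      · rintro (h | h)
        exacts [⟨2, h, by simp⟩, ⟨3, h, by simp⟩]
    rw [hG, frankl, mem_filter, mem_powersetCard, h23, hne]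
    simp [insert_subset_iff]
  have key : ∀ (m : ℕ) (I J : Finset ℕ), 1 ≤ m → I ⊆ Icc 1 (k + q + 4) → #I = 2 → Disjoint I J →
      (∀ x ∈ I, x < m) → (∀ x ∈ J, x < m) →
      ((1 ∈ I ∧ (2 ∈ I ∨ 3 ∈ I)) ∨ (2 ∈ I ∧ 3 ∈ I)) →
      (k + q + 5 - m).choose k ≤ #(link G I J) := by
    intro m I J hm hI hI2 hIJ hIm hJm h
    rw [show k + q + 5 - m = #(Icc m (k + q + 4)) by rw [Nat.card_Icc], ← card_powersetCard]
    refine card_le_card fun B hB => ?_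
    rw [mem_powersetCard] at hB
    have hBm : ∀ x ∈ B, m ≤ x := fun x hx => (mem_Icc.1 (hB.1 hx)).1
    have hBI : Disjoint B I := disjoint_left.2 fun x hx hx' => (hIm x hx').not_ge (hBm x hx)
    have hBJ : Disjoint B J := disjoint_left.2 fun x hx hx' => (hJm x hx').not_ge (hBm x hx)
    rw [mem_link hIJ, hmemG]
    refine ⟨hBI, hBJ, ⟨union_subset (hB.1.trans (Icc_subset_Icc_left hm)) hI, ?_⟩, ?_⟩
    · rw [card_union_of_disjoint hBI, hB.2, hI2]
    · simp only [mem_union]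
      tauto
  have s0 := card_link_split (x := 1) G ∅ ∅
  have s1 := card_link_split (x := 2) G {1} ∅
  have s2 := card_link_split (x := 3) G {1} {2}
  have s3 := card_link_split (x := 2) G ∅ {1}
  have s4 := card_link_split (x := 3) G {2} {1}
  rw [card_link_empty] at s0
  simp only [insert_empty_eq] at s0 s1 s2 s3 s4
  have k1 := key 3 {2, 1} ∅ (by omega) (by simp [insert_subset_iff]) (by simp) (by simp) (by simp)
    (by simp) (by simp)
  have k2 := key 4 {3, 1} {2} (by omega) (by simp [insert_subset_iff]) (by simp) (by simp)
    (by simp) (by simp) (by simp)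
  have k3 := key 4 {3, 2} {1} (by omega) (by simp [insert_subset_iff]) (by simp) (by simp)
    (by simp) (by simp) (by simp)
  rw [show k + q + 5 - 3 = k + q + 2 by omega] at k1
  rw [show k + q + 5 - 4 = k + q + 1 by omega] at k2 k3
  omega

/-- An intersecting family larger than the two-out-of-three family has a vertex which is missed by
a small proportion of its members. -/
theorem exists_card_notMem_mul_lt {n k : ℕ} (hn : 36 * k < n) {F : Finset (Finset ℕ)}
    (hF : F ⊆ powersetCard k (Icc 1 n)) (hint : ∀ A ∈ F, ∀ B ∈ F, ¬ Disjoint A B)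
    (hcard : #(frankl n k 3) < #F) :
    ∃ x ∈ Icc 1 n, #(F.filter fun A => x ∉ A) * (3 * n) < 40 * k * #F := by
  have hpos : 0 < #F := by omega
  rcases le_or_gt k 1 with hk | hk
  · obtain ⟨A, hA⟩ := card_pos.1 hpos
    have hA' := mem_powersetCard.1 (hF hA)
    obtain ⟨x, hx⟩ : A.Nonempty := by
      by_contra! h
      exact hint A hA A hA (h ▸ disjoint_empty_left _)
    have hk0 : 0 < k := by rw [← hA'.2]; exact card_pos.2 ⟨x, hx⟩
    refine ⟨x, hA'.1 hx, ?_⟩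
    -- Pairwise intersecting sets of size at most one all coincide.
    have : F.filter (fun A => x ∉ A) = ∅ := by
      rw [filter_eq_empty_iff]
      intro B hB hxB
      refine hint A hA B hB (disjoint_left.2 fun y hy hyB => hxB ?_)
      rwa [card_le_one.1 (by omega) x hx y hy]
    rw [this, card_empty, zero_mul]
    positivity
  obtain ⟨k, rfl⟩ : ∃ l, k = l + 2 := ⟨k - 2, by omega⟩
  obtain ⟨q, rfl⟩ : ∃ q, n = k + q + 4 := ⟨n - k - 4, by omega⟩
  have hcard' := (le_card_frankl_three k q).trans_lt hcard
  obtain ⟨x, hx, hle⟩ := exists_card_notMem_le (by omega) F hF hint hcard'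
  refine ⟨x, hx, ?_⟩
  have h := card_notMem_le_of_le (by omega) hF hint hcard' hx hle
  rw [card_link_singleton] at h
  have e1 : (k + q + 1).choose (q + 1) = (k + q + 1).choose k :=
    Nat.choose_symm_of_eq_add (by omega)
  have e2 := Nat.choose_mul_succ_eq (k + q) (q + 1)
  rw [e1, show k + q + 1 - (q + 1) = k by omega] at e2
  -- The slack n ≤ 4(n-3) turns 3n into 12(n-3), and `e2` says (n-3)·C(n-4,q+1) = k·C(n-3,k).
  calc #(F.filter fun A => x ∉ A) * (3 * (k + q + 4))
      ≤ (k + q).choose (q + 1) * (12 * (k + q + 1)) := Nat.mul_le_mul h (by omega)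
    _ = 12 * k * (k + q + 1).choose k := by linarith
    _ ≤ 12 * k * #F := by gcongr; omega
    _ < 40 * (k + 2) * #F := by gcongr <;> omega

/-- The degree ratio of an intersecting family larger than the two-out-of-three family. -/
theorem one_sub_lt_degreeRatio {n k : ℕ} (hn : 36 * k < n) {F : Finset (Finset ℕ)}
    (hF : F ⊆ powersetCard k (Icc 1 n)) (hint : ∀ A ∈ F, ∀ B ∈ F, ¬ Disjoint A B)
    (hcard : #(frankl n k 3) < #F) {c : ℝ} (hc : 40 ≤ c) :
    1 - c * ((k : ℝ) / (3 * (n : ℝ))) < degreeRatio n F := by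
  obtain ⟨x, hx, hlt⟩ := exists_card_notMem_mul_lt hn hF hint hcard
  have hF0 : (0 : ℝ) < #F := by exact_mod_cast (by omega : 0 < #F)
  have hn0 : (0 : ℝ) < n := by exact_mod_cast (by omega : 0 < n)
  have hdeg : degree F x ≤ maxDegree n F := le_sup (f := degree F) hx
  have hsum : degree F x + #(F.filter fun A => x ∉ A) = #F :=
    card_filter_add_card_filter_not _
  have hdeg' : (degree F x : ℝ) ≤ maxDegree n F := by exact_mod_cast hdeg
  have hsum' : (degree F x : ℝ) + #(F.filter fun A => x ∉ A) = #F := by exact_mod_cast hsum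
  have hlt' : (#(F.filter fun A => x ∉ A) : ℝ) * (3 * n) < 40 * k * #F := by exact_mod_cast hlt
  have hmiss : (#(F.filter fun A => x ∉ A) : ℝ) < 40 * (k / (3 * n)) * #F := by
    rw [show 40 * ((k : ℝ) / (3 * n)) * #F = 40 * k * #F / (3 * n) by ring,
      lt_div_iff₀ (by positivity)]
    exact hlt'
  have hmono : 40 * ((k : ℝ) / (3 * n)) * #F ≤ c * (k / (3 * n)) * #F := by gcongr
  rw [degreeRatio, lt_div_iff₀ hF0]
  linarith

end IntersectingFamilies

theorem corollary1p14 (n k : ℕ) (hn : 36 * k < n) (F : Finset (Finset ℕ))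
    (hF : F ⊆ Finset.powersetCard k (Finset.Icc 1 n))
    (hint : (F : Set (Finset ℕ)).Intersecting)
    (hcard : (IntersectingFamilies.frankl n k 3).card + 1 ≤ F.card) :
    IntersectingFamilies.degreeRatio n F
        > 1 - max ((k : ℝ) + 4) 40 * ((k : ℝ) / (3 * (n : ℝ))) ∧
      ∀ d : ℕ, 40 ≤ d →
        ((IntersectingFamilies.frankl n k 3).card : ℝ)
            + (d : ℝ) / 2 *
              (IntersectingFamilies.binom ((n : ℤ) - d + 3) ((k : ℤ) - d + 3) : ℝ)
          ≤ (F.card : ℝ) →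
        IntersectingFamilies.degreeRatio n F > 1 - (d : ℝ) * (k : ℝ) / (3 * (n : ℝ)) := by
  have hint' : ∀ A ∈ F, ∀ B ∈ F, ¬ Disjoint A B := fun A hA B hB => hint hA hB
  refine ⟨IntersectingFamilies.one_sub_lt_degreeRatio hn hF hint' hcard (le_max_right _ _),
    fun d hd _ => ?_⟩
  rw [mul_div_assoc]
  exact IntersectingFamilies.one_sub_lt_degreeRatio hn hF hint' hcard (by exact_mod_cast hd)
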